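/- \textbf{Setting.} Fix a term algebra: a non-empty set of values, operators with an arity and an interpretation on values, and action labels. Expressions are built from values, variables and operators; guards are expressions that hold when their value is true; action terms are $a(e_1,\dots,e_n)$, with signature $(a,n)$. A \emph{pLTS} has states, an initial state, a set $V$ of variables (some possibly with an initial value) and transitions labelled by an action whose parameters are input variables $?x$ (each occurring once) or expressions over $V$, a guard, and parallel assignments to variables of $V$; guard and assigned expressions use $V$ and the input variables. A \emph{pNet} is a pLTS or a node $\langle P_i^{i\in I},\mathrm{Sort}_j^{j\in J},\mathrm{SV}_k^{k\in K}\rangle$ with sub-pNets $P_i$, holes $j\in J$ with sorts (sets of action signatures), and synchronisation vectors $(\alpha_l)^{l\in I_k\uplus J_k}\to\alpha'_k\,[e_k]$, $I_k\subseteq I$, $J_k\subseteq J$. It is required that $I\cap J=\emptyset$ and $I\cup J\ne\emptyset$, that the $P_i$ have pairwise disjoint variables and pairwise disjoint holes, the latter also disjoint from $J$, that the signature of $\alpha_l$ lies in the sort of $P_l$ or $\mathrm{Sort}_l$, and that $\alpha'_k$ and $e_k$ use only variables of the $\alpha_l$. The sort of a pLTS or a node is the set of signatures of the actions on its transitions,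 respectively of the resulting actions $\alpha'_k$. For $j_0\in J$ and a pNet $Q$, $P[Q]_{j_0}$ is obtained by removing $j_0$ from the holes of $P$ and putting $Q$ as sub-pNet at $j_0$. An \emph{open transition} from a state $s$ to a state $s'$ consists of actions $\beta_j$ of some holes ($j\in J'$), a predicate, a parallel assignment $\mathrm{Post}$ to the variables, and a resulting action $\alpha$; besides the variables of the automaton it may use free variables. An \emph{open automaton} has sorted holes, states, an initial state, variables (some possibly with an initial value), and a set of open transitions closed under substituting expressions for free variables and under strengthening the predicate. The automaton of a pNet has as states the tuples of states of its leaves (the pLTSs in it; a pLTS is its own single leaf), as variables the disjoint union of the variables of its leaves, as holes all holes of the pNet and its sub-pNets, and as open transitions those generated in this way from two rules. (1) A transition of a pLTS gives an open transition with no hole action, its guard as predicate and its assignments as $\mathrm{Post}$. (2) For a node, a vector $\mathrm{SV}_k$, open transitions of the $P_i$, $i\in I_k$, with actions $\alpha_i^\circ$, fresh actions $\beta_j$ with signature in $\mathrm{Sort}_j$ for $j\in J_k$, and a fresh action $\alpha$ give an open transition with action $\alpha$; its hole actions are the $\beta_j$ together with the hole actions of the sub-transitions; its predicate is the conjunction of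 those of the sub-transitions, of $\alpha_i^\circ=\alpha_i$ ($i\in I_k$), $\beta_j=\alpha_j$ ($j\in J_k$), $\alpha=\alpha'_k$ and $e_k$; its $\mathrm{Post}$ is the union of those of the sub-transitions; leaves of the other sub-pNets do not move. The variables of $\mathrm{SV}_k$, of the fresh actions and the free variables of the sub-transitions are kept distinct. Let $A_1,A_2$ be open automata with the same holes of the same sorts and with disjoint variables $V_1,V_2$ (made disjoint by renaming if necessary). A relation assigning to each pair of states $(s,t)$ a predicate $\mathrm{Pred}_{s,t}$ over $V_1\uplus V_2$ is an \emph{FH-bisimulation} if for all $s,t$ and every open transition of $A_1$ from $s$ to $s'$ with data $\beta_j^{j\in J'},\mathrm{Pred},\mathrm{Post},\alpha$ there is a (possibly infinite) family, indexed by $x\in X$, of open transitions of $A_2$ from $t$ to $t_x$ with data $\beta_{jx}^{j\in J'},\mathrm{Pred}_x,\mathrm{Post}_x,\alpha_x$ such that, for all values of the variables, \[\mathrm{Pred}_{s,t}\wedge\mathrm{Pred}\implies\bigvee_{x\in X}\bigl(\forall j\in J'.\,\beta_j=\beta_{jx}\ \wedge\ \mathrm{Pred}_x\ \wedge\ \alpha=\alpha_x\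 \wedge\ \mathrm{Pred}_{s',t_x}\{\mathrm{Post}\uplus\mathrm{Post}_x\}\bigr),\] and symmetrically for the open transitions of $A_2$. Two pNets are \emph{FH-bisimilar} if there is an FH-bisimulation between their automata whose predicate for the two initial states is satisfied by some valuations agreeing with the given initial values. \textbf{Theorem (Context equivalence).} Let $P$ and $P'$ be FH-bisimilar open pNets, let $j_0$ be a hole of the root node of $P$ and of that of $P'$, and let $Q$ be a pNet whose sort is the sort of $j_0$ and whose holes are distinct from the holes of $P$ other than $j_0$. Then $P[Q]_{j_0}$ and $P'[Q]_{j_0}$ are FH-bisimilar. -/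

import Mathlib

namespace PNets

/-! ### Term algebra -/

/-- The data over which expressions and actions are built. It is left unspecified: values,
operators with an arity and an interpretation, the values that count as "true" (a guard is an
expression, satisfied when its value is true), and the action labels. -/
structure TermAlgebra where
  Val : Type
  nonempty_val : Nonempty Val
  Op : Type
  arity : Op → ℕ
  interp : (f : Op) → (Fin (arity f) → Val) → Val
  truth : Set Val
  Lab : Type

/-- Expressions with variables in `X`. -/
inductive Expr (A : TermAlgebra) (X : Type) : Type
  | val (c : A.Val) : Expr A X
  | var (x : X) : Expr A X
  | op (f : A.Op) (args : Fin (A.arity f) → Expr A X) : Expr A X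

namespace Expr

variable {A : TermAlgebra} {X Y : Type}

/-- Parallel substitution of expressions for variables. -/
def subst (σ : X → Expr A Y) : Expr A X → Expr A Y
  | val c => val c
  | var x => σ x
  | op f args => op f (fun i => (args i).subst σ)

/-- Renaming of variables. -/
def map (r : X → Y) (e : Expr A X) : Expr A Y := e.subst (fun x => var (r x))

/-- Value of an expression under a valuation of its variables. -/
def eval (v : X → A.Val) : Expr A X → A.Val
  | val c => c
  | var x => v x
  | op f args => A.interp f (fun i => (args i).eval v)

/-- The set of variables of an expression. -/
def vars : Expr A X → Set X
  | val _ => ∅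
  | var x => {x}
  | op _ args => {x | ∃ i, x ∈ (args i).vars}

end Expr

/-- Action signatures: a label and an arity. -/
abbrev Sig (A : TermAlgebra) : Type := A.Lab × ℕ

/-- Action terms `a(e₁, …, eₙ)` (input variables are not distinguished). -/
structure Action (A : TermAlgebra) (X : Type) where
  lab : A.Lab
  args : List (Expr A X)

namespace Action

variable {A : TermAlgebra} {X Y : Type}

def sig (a : Action A X) : Sig A := (a.lab, a.args.length)

def subst (σ : X → Expr A Y) (a : Action A X) : Action A Y :=
  ⟨a.lab, a.args.map (Expr.subst σ)⟩

def map (r : X → Y) (a : Action A X) : Action A Y :=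
  a.subst (fun x => Expr.var (r x))

/-- The action under a valuation. Two action terms are equal under valuations when these
results agree (same label, same values of the parameters). -/
def eval (v : X → A.Val) (a : Action A X) : A.Lab × List A.Val :=
  (a.lab, a.args.map (Expr.eval v))

def vars (a : Action A X) : Set X := {x | ∃ e ∈ a.args, x ∈ e.vars}

end Action

/-! ### Parameterised labelled transition systems -/

/-- Parameters of the actions of a pLTS: `?x` with `x` an input variable (in `X`), or an
expression over the variables `V` of the pLTS. -/
inductive Param (A : TermAlgebra) (V X : Type) : Type
  | input (x : X) : Param A V X
  | expr (e : Expr A V) : Param A V X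

/-- Labels `⟨α, e_b, (x_j := e_j)^{j ∈ J}⟩` of a pLTS with variables `V`. `Input` is the set
`iv(α)` of input variables of `α`; each of them occurs exactly once, as a parameter `?x`, so that
the variables of `α` that are not input variables are in `V`. Guard and assigned expressions
are over `V ∪ iv(α)`. -/
structure PLabel (A : TermAlgebra) (V : Type) where
  Input : Type
  lab : A.Lab
  params : List (Param A V Input)
  linear : ∀ x : Input, ∃! n : ℕ, params[n]? = some (Param.input x)
  guard : Expr A (V ⊕ Input)
  assign : V → Option (Expr A (V ⊕ Input))

/-- The action of a label with the input markers removed. -/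
def PLabel.act {A : TermAlgebra} {V : Type} (l : PLabel A V) : Action A (V ⊕ l.Input) where
  lab := l.lab
  args := l.params.map fun
    | Param.input x => Expr.var (Sum.inr x)
    | Param.expr e => e.map Sum.inl

/-- A pLTS `⟨S, s₀, V, →⟩`. A variable may have an initial value. -/
structure PLTS (A : TermAlgebra) where
  State : Type
  init : State
  Var : Type
  initVal : Var → Option A.Val
  trans : State → PLabel A Var → State → Prop

/-! ### pNets -/

/-- A synchronisation vector `(α_l)^{l ∈ I_k ⊎ J_k} → α' [e]` for sub-pNets indexed by `I` and
holes named in `N`. The partial families `sub` and `hole` have domains `I_k` and `J_k`. Its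
variables form a type of its own, since vectors are identified modulo renaming. -/
structure SyncVec (A : TermAlgebra) (I N : Type) where
  X : Type
  sub : I → Option (Action A X)
  hole : N → Option (Action A X)
  res : Action A X
  guard : Expr A X

namespace SyncVec

variable {A : TermAlgebra} {I N : Type}

/-- The index set `I_k` of the sub-pNets involved in the vector. -/
def Subs (v : SyncVec A I N) : Type := {i : I // (v.sub i).isSome}

/-- The index set `J_k` of the holes involved in the vector. -/
def Holes (v : SyncVec A I N) : Type := {j : N // (v.hole j).isSome}

def subAct (v : SyncVec A I N) (i : v.Subs) : Action A v.X := (v.sub i.1).get i.2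

def holeAct (v : SyncVec A I N) (j : v.Holes) : Action A v.X := (v.hole j.1).get j.2

/-- The variables of the actions `α_l`. -/
def actVars (v : SyncVec A I N) : Set v.X :=
  {x | (∃ i, x ∈ (v.subAct i).vars) ∨ ∃ j, x ∈ (v.holeAct j).vars}

/-- The predicate of the vector, given the values of its variables and the (valued) actions
of the sub-pNets, of the holes, and of the resulting action. -/
def Pred (v : SyncVec A I N) (val : v.X → A.Val) (α : v.Subs → A.Lab × List A.Val)
    (β : v.Holes → A.Lab × List A.Val) (res : A.Lab × List A.Val) : Prop :=
  (∀ i, α i = (v.subAct i).eval val) ∧ (∀ j, β j = (v.holeAct j).eval val) ∧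
    res = v.res.eval val ∧ v.guard.eval val ∈ A.truth

open Classical in
/-- The same vector when the hole `j₀` has become the additional sub-pNet `none`. -/
noncomputable def fill (v : SyncVec A I N) (j₀ : N) : SyncVec A (Option I) N where
  X := v.X
  sub
    | none => v.hole j₀
    | some i => v.sub i
  hole := Function.update v.hole j₀ none
  res := v.res
  guard := v.guard

end SyncVec

/-- pNets: a pLTS, or a node with a family of sub-pNets, a partial family `hole` of sorts
indexed by hole names (its domain is the set `J` of holes of the node), and a family of
synchronisation vectors. The side conditions are in `PNet.WF`. -/
inductive PNet (A : TermAlgebra) (N : Type) : Type 1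
  | plts (p : PLTS A) : PNet A N
  | node {I K : Type} (sub : I → PNet A N) (hole : N → Option (Set (Sig A)))
      (sv : K → SyncVec A I N) : PNet A N

namespace PNet

variable {A : TermAlgebra} {N : Type}

/-- The sort of a pNet: the signatures of the actions it can perform. -/
def sort : PNet A N → Set (Sig A)
  | plts p => {g | ∃ s l s', p.trans s l s' ∧ g = l.act.sig}
  | node _ _ sv => {g | ∃ k, g = (sv k).res.sig}

/-- The sorts of the holes of the root of the pNet itself (a partial family). -/
def rootHole : PNet A N → N → Option (Set (Sig A))
  | plts _ => fun _ => none
  | node _ hole _ => hole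

/-- All the holes of a pNet (its own and those of its sub-pNets) with their sorts: the pair
`(j, S)` says that `j` is a hole of sort `S`. -/
def sortedHoles : PNet A N → Set (N × Set (Sig A))
  | plts _ => ∅
  | node sub hole _ => {x | hole x.1 = some x.2 ∨ ∃ i, x ∈ (sub i).sortedHoles}

/-- The set of names of all the holes of a pNet. -/
def holes (P : PNet A N) : Set N := {j | ∃ S, (j, S) ∈ P.sortedHoles}

/-- The conditions in the definition of pNets. Variables of distinct sub-pNets, and indices of
sub-pNets and of holes, are distinct by construction. -/
def WF : PNet A N → Prop
  | plts _ => True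
  | @node _ _ I _ sub hole sv =>
      (∀ i, (sub i).WF) ∧
      (Nonempty I ∨ ∃ j, (hole j).isSome) ∧
      (∀ i, ∀ j ∈ (sub i).holes, hole j = none) ∧
      (∀ i₁ i₂, i₁ ≠ i₂ → Disjoint (sub i₁).holes (sub i₂).holes) ∧
      ∀ k,
        (∀ i, ((sv k).subAct i).sig ∈ (sub i.1).sort) ∧
        (∀ j, ∃ S, hole j.1 = some S ∧ ((sv k).holeAct j).sig ∈ S) ∧
        (sv k).res.vars ⊆ (sv k).actVars ∧ (sv k).guard.vars ⊆ (sv k).actVars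

open Classical in
/-- Composition `P[Q]_{j₀}`: the hole `j₀` of the root of `P` is removed from the holes, and `Q`
becomes a sub-pNet, of index `none`, at its place. -/
noncomputable def fill (P : PNet A N) (j₀ : N) (Q : PNet A N) : PNet A N :=
  match P with
  | plts p => plts p
  | node sub hole sv =>
      node (fun | none => Q | some i => sub i) (Function.update hole j₀ none)
        (fun k => (sv k).fill j₀)

/-- The index set of the leaves of a pNet; a pLTS is its own single leaf. -/
def Leaf : PNet A N → Type
  | plts _ => Unit
  | @node _ _ I _ sub _ _ => Σ i : I, (sub i).Leaf

/-- The pLTSs at the leaves. -/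
def leaf : (P : PNet A N) → P.Leaf → PLTS A
  | plts p => fun _ => p
  | node sub _ _ => fun l => (sub l.1).leaf l.2

/-- The states of a pNet: tuples of states of its leaves. -/
def State (P : PNet A N) : Type := (l : P.Leaf) → (P.leaf l).State

def initState (P : PNet A N) : P.State := fun l => (P.leaf l).init

/-- The variables of a pNet: the disjoint union of the variables of its leaves. -/
def Var (P : PNet A N) : Type := Σ l : P.Leaf, (P.leaf l).Var

def initVal (P : PNet A N) : P.Var → Option A.Val := fun x => (P.leaf x.1).initVal x.2

end PNet

/-! ### Open transitions and open automata -/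

/-- Open transitions over hole names `N`, variables `V` and states `S`, whose terms may also use
the free variables in `F`. The family `hole` of actions `β_j` has domain `J'`; the predicate is
a set of valuations (predicates are identified modulo equivalence); `post` is a partial
family of assignments to variables in `V`. -/
structure OpenTransition (A : TermAlgebra) (N V S F : Type) where
  hole : N → Option (Action A (V ⊕ F))
  pred : (V ⊕ F → A.Val) → Prop
  post : V → Option (Expr A (V ⊕ F))
  act : Action A (V ⊕ F)
  src : S
  tgt : S

namespace OpenTransition

variable {A : TermAlgebra} {N V S F F' : Type}

/-- Substitution of the free variables, and strengthening of the predicate by `q`. -/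
def refine (o : OpenTransition A N V S F) (σ : F → Expr A (V ⊕ F'))
    (q : (V ⊕ F' → A.Val) → Prop) : OpenTransition A N V S F' where
  hole j := (o.hole j).map (Action.subst (Sum.elim (fun x => Expr.var (Sum.inl x)) σ))
  pred v := o.pred (fun x => (Sum.elim (fun x => Expr.var (Sum.inl x)) σ x).eval v) ∧ q v
  post x := (o.post x).map (Expr.subst (Sum.elim (fun x => Expr.var (Sum.inl x)) σ))
  act := o.act.subst (Sum.elim (fun x => Expr.var (Sum.inl x)) σ)
  src := o.src
  tgt := o.tgt

/-- The values of the variables after the transition: all assignments are done in parallel,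
with the values before the transition. -/
def after (o : OpenTransition A N V S F) (ρ : V → A.Val) (φ : F → A.Val) : V → A.Val :=
  fun x => (o.post x).elim (ρ x) (Expr.eval (Sum.elim ρ φ))

end OpenTransition

/-- Open automata. The set of open transitions is closed under substitution of the free
variables and refinement of the predicate. A set of holes with their sorts is given as a set of
pairs; `initVal` gives the initial values of those variables that have one. -/
structure OpenAutomaton (A : TermAlgebra) (N : Type) where
  holes : Set (N × Set (Sig A))
  State : Type
  init : State
  Var : Type
  initVal : Var → Option A.Val
  trans : (F : Type) → Set (OpenTransition A N Var State F)
  typed : ∀ F, ∀ o ∈ trans F, ∀ j β, o.hole j = some β → ∃ S, (j, S) ∈ holes ∧ β.sig ∈ S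
  closed : ∀ F F', ∀ o ∈ trans F, ∀ (σ : F → Expr A (Var ⊕ F'))
    (q : (Var ⊕ F' → A.Val) → Prop), o.refine σ q ∈ trans F'

/-- A valuation that agrees with the initial values. -/
def OpenAutomaton.IsInitial {A : TermAlgebra} {N : Type} (M : OpenAutomaton A N)
    (ρ : M.Var → A.Val) : Prop :=
  ∀ x c, M.initVal x = some c → ρ x = c

/-- A relation between the states of two open automata constrained by predicates: each pair of
states comes with a predicate on the values of the variables of the two automata. The two
sets of variables are kept disjoint: a predicate has one valuation for each. A pair
that is not related has the predicate that is always false. -/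
abbrev StateRel {A : TermAlgebra} {N : Type} (M₁ M₂ : OpenAutomaton A N) : Type :=
  M₁.State → M₂.State → (M₁.Var → A.Val) → (M₂.Var → A.Val) → Prop

/-- Every open transition of `M₁` from `s` is covered by a family of open transitions of `M₂`
from `t`, for all `s` and `t`. -/
def Simulates {A : TermAlgebra} {N : Type} (M₁ M₂ : OpenAutomaton A N)
    (R : StateRel M₁ M₂) : Prop :=
  ∀ (s : M₁.State) (t : M₂.State) (F : Type), ∀ o ∈ M₁.trans F, o.src = s →
    ∃ (X : Type) (o' : X → OpenTransition A N M₂.Var M₂.State F),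
      (∀ x, o' x ∈ M₂.trans F ∧ (o' x).src = t ∧
        ∀ j, (o.hole j).isSome = ((o' x).hole j).isSome) ∧
      ∀ (ρ₁ : M₁.Var → A.Val) (ρ₂ : M₂.Var → A.Val) (φ : F → A.Val),
        R s t ρ₁ ρ₂ → o.pred (Sum.elim ρ₁ φ) →
        ∃ x, (∀ j, (o.hole j).map (Action.eval (Sum.elim ρ₁ φ)) =
              ((o' x).hole j).map (Action.eval (Sum.elim ρ₂ φ))) ∧
          (o' x).pred (Sum.elim ρ₂ φ) ∧
          o.act.eval (Sum.elim ρ₁ φ) = (o' x).act.eval (Sum.elim ρ₂ φ) ∧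
          R o.tgt (o' x).tgt (o.after ρ₁ φ) ((o' x).after ρ₂ φ)

/-- Strong FH-bisimulations. -/
structure IsFHBisimulation {A : TermAlgebra} {N : Type} (M₁ M₂ : OpenAutomaton A N)
    (R : StateRel M₁ M₂) : Prop where
  holes_eq : M₁.holes = M₂.holes
  left : Simulates M₁ M₂ R
  right : Simulates M₂ M₁ (fun t s ρ₂ ρ₁ => R s t ρ₁ ρ₂)

/-! ### Semantics of pNets -/

/-- The free variables of an open transition of a pNet node: those of the synchronisation vector
(`X`), of the open transitions of the sub-pNets (`FI`), of the actions of the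
holes (`B`) and of the resulting action (`C`). These sets are disjoint, and disjoint from the
variables of the pNet: this is the freshness condition. -/
inductive NodeFree {I J : Type} (X : Type) (FI : I → Type) (B : J → Type) (C : Type) : Type
  | vec (x : X) : NodeFree X FI B C
  | sub (i : I) (x : FI i) : NodeFree X FI B C
  | hole (j : J) (x : B j) : NodeFree X FI B C
  | res (x : C) : NodeFree X FI B C

namespace PNet

variable {A : TermAlgebra} {N : Type}

/-- Open transitions of `P`, each with its type of free variables. -/
abbrev OT (P : PNet A N) : Type 1 := Σ F : Type, OpenTransition A N P.Var P.State F

/-- The open transition of a pLTS given by one of its transitions. -/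
def leafOT (p : PLTS A) (s : p.State) (l : PLabel A p.Var) (s' : p.State) :
    (plts p : PNet A N).OT :=
  let r : p.Var ⊕ l.Input → (plts p : PNet A N).Var ⊕ l.Input := Sum.map (fun x => ⟨(), x⟩) id
  ⟨l.Input,
    { hole := fun _ => none
      pred := fun v => l.guard.eval (v ∘ r) ∈ A.truth
      post := fun x => (l.assign x.2).map (Expr.map r)
      act := l.act.map r
      src := fun _ => s
      tgt := fun _ => s' }⟩

/-- Inclusion of the variables (those of the pNet and the free ones) of the open transition
`prem i` of a sub-pNet in those of the open transition of the node. -/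
def inclVar {I K : Type} {sub : I → PNet A N} (hole : N → Option (Set (Sig A)))
    {sv : K → SyncVec A I N} {k : K} (prem : (i : (sv k).Subs) → (sub i.1).OT)
    (B : (sv k).Holes → Type) (C : Type) (i : (sv k).Subs) :
    (sub i.1).Var ⊕ (prem i).1 →
      (node sub hole sv).Var ⊕ NodeFree (sv k).X (fun i => (prem i).1) B C :=
  Sum.map (fun x => ⟨⟨i.1, x.1⟩, x.2⟩) (NodeFree.sub (FI := fun i => (prem i).1) i)

open Classical in
/-- The open transition of a node given by the vector `k`, open transitions `prem` of the
sub-pNets involved, fresh actions `β` of the holes involved, a fresh resulting action `α`, the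
source and target states, and the family `H` of all actions of holes. -/
noncomputable def nodeOT {I K : Type} {sub : I → PNet A N}
    {hole : N → Option (Set (Sig A))} {sv : K → SyncVec A I N} (k : K)
    (prem : (i : (sv k).Subs) → (sub i.1).OT)
    (B : (sv k).Holes → Type) (β : (j : (sv k).Holes) → Action A (B j))
    (C : Type) (α : Action A C) (s s' : (node sub hole sv).State)
    (H : N → Option (Action A ((node sub hole sv).Var ⊕
      NodeFree (sv k).X (fun i => (prem i).1) B C))) :
    (node sub hole sv).OT :=
  ⟨NodeFree (sv k).X (fun i => (prem i).1) B C,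
    { hole := H
      pred := fun v =>
        (∀ i, (prem i).2.pred (v ∘ inclVar hole prem B C i)) ∧
        (sv k).Pred (fun x => v (Sum.inr (NodeFree.vec x)))
          (fun i => (prem i).2.act.eval (v ∘ inclVar hole prem B C i))
          (fun j => (β j).eval (fun x => v (Sum.inr (NodeFree.hole j x))))
          (α.eval (fun x => v (Sum.inr (NodeFree.res x))))
      post := fun x =>
        if h : ((sv k).sub x.1.1).isSome then
          ((prem ⟨x.1.1, h⟩).2.post ⟨x.1.2, x.2⟩).map (Expr.map (inclVar hole prem B C ⟨x.1.1, h⟩))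
        else none
      act := α.map (fun x => Sum.inr (NodeFree.res x))
      src := s
      tgt := s' }⟩

/-- The relation `P ⊨ OT`, as the set of the open transitions `OT` with `P ⊨ OT`, by the rule for
pLTSs and the rule for nodes. -/
def Models : (P : PNet A N) → Set P.OT
  | plts p => {o | ∃ s l s', p.trans s l s' ∧ o = leafOT p s l s'}
  | @node _ _ I K sub hole sv => {o |
      ∃ (k : K) (prem : (i : (sv k).Subs) → (sub i.1).OT)
        (B : (sv k).Holes → Type) (β : (j : (sv k).Holes) → Action A (B j))
        (C : Type) (α : Action A C) (s s' : (node sub hole sv).State)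
        (H : N → Option (Action A ((node sub hole sv).Var ⊕
          NodeFree (sv k).X (fun i => (prem i).1) B C))),
        (∀ i, prem i ∈ (sub i.1).Models) ∧
        -- the states of the leaves of the sub-pNets involved
        (∀ i, (fun l => s ⟨i.1, l⟩) = (prem i).2.src ∧
          (fun l => s' ⟨i.1, l⟩) = (prem i).2.tgt) ∧
        -- the other leaves do not move
        (∀ (i : I) (l : (sub i).Leaf), ((sv k).sub i).isNone → s' ⟨i, l⟩ = s ⟨i, l⟩) ∧
        -- the actions of the holes are in their sorts
        (∀ j, ∃ S, hole j.1 = some S ∧ (β j).sig ∈ S) ∧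
        -- `H` is the union of the actions of the holes of the node and of the sub-pNets
        (∀ j a, H j = some a ↔
          (∃ h : ((sv k).hole j).isSome,
            a = (β ⟨j, h⟩).map (fun x => Sum.inr (NodeFree.hole ⟨j, h⟩ x))) ∨
          ∃ i a', (prem i).2.hole j = some a' ∧ a = a'.map (inclVar hole prem B C i)) ∧
        o = nodeOT k prem B β C α s s' H}

end PNet

/-! Helper facts: the automaton of a pNet is an open automaton. -/

theorem Expr.subst_subst {A : TermAlgebra} {X Y Z : Type} (σ : X → Expr A Y)
    (τ : Y → Expr A Z) (e : Expr A X) :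
    (e.subst σ).subst τ = e.subst (fun x => (σ x).subst τ) := by
  induction e with
  | val c => rfl
  | var x => rfl
  | op f args ih => simp only [Expr.subst, ih]

theorem Expr.eval_subst {A : TermAlgebra} {X Y : Type} (σ : X → Expr A Y)
    (v : Y → A.Val) (e : Expr A X) :
    (e.subst σ).eval v = e.eval (fun x => (σ x).eval v) := by
  induction e with
  | val c => rfl
  | var x => rfl
  | op f args ih => simp only [Expr.subst, Expr.eval, ih]

theorem Action.subst_subst {A : TermAlgebra} {X Y Z : Type} (σ : X → Expr A Y)
    (τ : Y → Expr A Z) (a : Action A X) :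
    (a.subst σ).subst τ = a.subst (fun x => (σ x).subst τ) := by
  simp [Action.subst, Expr.subst_subst, Function.comp_def]

theorem Action.sig_subst {A : TermAlgebra} {X Y : Type} (σ : X → Expr A Y)
    (a : Action A X) : (a.subst σ).sig = a.sig := by
  simp [Action.subst, Action.sig]

theorem OpenTransition.refine_refine {A : TermAlgebra} {N V S F F' F'' : Type}
    (o : OpenTransition A N V S F) (σ : F → Expr A (V ⊕ F')) (q : (V ⊕ F' → A.Val) → Prop)
    (τ : F' → Expr A (V ⊕ F'')) (q' : (V ⊕ F'' → A.Val) → Prop) :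
    (o.refine σ q).refine τ q' =
      o.refine (fun x => (σ x).subst (Sum.elim (fun x => Expr.var (Sum.inl x)) τ))
        (fun v => q (fun x => (Sum.elim (fun x => Expr.var (Sum.inl x)) τ x).eval v) ∧ q' v) := by
  have key : (fun x : V ⊕ F => (Sum.elim (fun x => Expr.var (Sum.inl x)) σ x).subst
      (Sum.elim (fun x => Expr.var (Sum.inl x)) τ)) =
      Sum.elim (fun x => Expr.var (Sum.inl x))
        (fun x => (σ x).subst (Sum.elim (fun x => Expr.var (Sum.inl x)) τ)) := by
    funext x
    cases x <;> rfl
  unfold OpenTransition.refine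
  congr 1
  · funext j
    simp only [Option.map_map, Function.comp_def, Action.subst_subst, key]
  · funext v
    simp only [← Expr.eval_subst, ← and_assoc, ← key]
  · funext x
    simp only [Option.map_map, Function.comp_def, Expr.subst_subst, key]
  · simp only [Action.subst_subst, key]

theorem PNet.typed_of_models {A : TermAlgebra} {N : Type} (P : PNet A N) :
    ∀ o ∈ P.Models, ∀ j β, o.2.hole j = some β →
      ∃ S, (j, S) ∈ P.sortedHoles ∧ β.sig ∈ S := by
  induction P with
  | plts p =>
    rintro o ⟨s, l, s', -, rfl⟩ j β h
    simp [PNet.leafOT] at h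
  | node sub hole sv ih =>
    rintro o ⟨k, prem, B, β, C, α, s, s', H, hprem, -, -, hβ, hH, rfl⟩ j b h
    rcases (hH j b).1 h with ⟨hj, rfl⟩ | ⟨i, a', ha', rfl⟩
    · obtain ⟨S, h1, h2⟩ := hβ ⟨j, hj⟩
      exact ⟨S, Or.inl h1, Set.mem_of_eq_of_mem (Action.sig_subst _ _) h2⟩
    · obtain ⟨S, h1, h2⟩ := ih i.1 _ (hprem i) j a' ha'
      exact ⟨S, Or.inr ⟨i.1, h1⟩, Set.mem_of_eq_of_mem (Action.sig_subst _ _) h2⟩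

/-- The semantics of a pNet: the open automaton generated, by substitution and refinement, by the
open transitions `OT` with `P ⊨ OT`. -/
def PNet.automaton {A : TermAlgebra} {N : Type} (P : PNet A N) : OpenAutomaton A N where
  holes := P.sortedHoles
  State := P.State
  init := P.initState
  Var := P.Var
  initVal := P.initVal
  trans F := {o | ∃ g ∈ P.Models, ∃ (σ : g.1 → Expr A (P.Var ⊕ F))
    (q : (P.Var ⊕ F → A.Val) → Prop), o = g.2.refine σ q}
  typed := by
    rintro F o ⟨g, hg, σ, q, rfl⟩ j β h
    obtain ⟨b, hb, rfl⟩ := Option.map_eq_some_iff.1 h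
    obtain ⟨S, h1, h2⟩ := P.typed_of_models g hg j b hb
    exact ⟨S, h1, by rwa [Action.sig_subst]⟩
  closed := by
    rintro F F' o ⟨g, hg, σ, q, rfl⟩ τ q'
    exact ⟨g, hg, _, _, OpenTransition.refine_refine _ _ _ _ _⟩

/-- FH-bisimilar pNets: some FH-bisimulation between their automata relates the initial states,
the predicate for these being satisfied by some valuations that agree with the initial
values. -/
def PNet.FHBisimilar {A : TermAlgebra} {N : Type} (P P' : PNet A N) : Prop :=
  ∃ R : StateRel P.automaton P'.automaton, IsFHBisimulation P.automaton P'.automaton R ∧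
    ∃ ρ ρ', P.automaton.IsInitial ρ ∧ P'.automaton.IsInitial ρ' ∧
      R P.automaton.init P'.automaton.init ρ ρ'

end PNets

namespace PNets

/-! The symbolic layer can be eliminated. The matching family in an FH-bisimulation may be infinite
and may contain any substitution instance of an open transition. It can therefore have one member
for each valuation satisfying the premise, with all free variables frozen at suitable values. Hence
an FH-bisimulation is an ordinary bisimulation between valued transitions, on configurations made of
a state and a valuation (`simulates_iff`).

For valued transitions, the node rule becomes a condition on a vector and a valuation of its
variables: the sub-pNets involved perform the values of their actions, the others stay put, and the
hole actions are collected (`NodeStep`). `Step.nodeStep` and `NodeStep.step` are the two directions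
of this translation. The second needs well-formedness, because the collected hole actions must form
a partial function and lie in the sorts.

A step of a composition then splits into a step of the context and, exactly when the context acts at
`j₀`, a step of `Q` whose result is that action (`nodeStep_fill_iff`). The only link between the two
parts is the valued action at `j₀`, which bisimilar contexts reproduce exactly. So the context step
is replaced by its match, the step of `Q` is kept, and the parts are reassembled
(`StepSimulates.fill`). The bisimulation is the given relation on the contexts together with
equality on the `Q` part. -/

/-! ### Evaluation of terms and valued actions. -/

theorem Expr.eval_map {A : TermAlgebra} {X Y : Type} (r : X → Y) (v : Y → A.Val) (e : Expr A X) :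
    (e.map r).eval v = e.eval (v ∘ r) :=
  Expr.eval_subst _ _ _

theorem Action.eval_subst {A : TermAlgebra} {X Y : Type} (σ : X → Expr A Y) (v : Y → A.Val)
    (a : Action A X) : (a.subst σ).eval v = a.eval (fun x => (σ x).eval v) := by
  simp [Action.subst, Action.eval, Function.comp_def, Expr.eval_subst]

theorem Action.eval_map {A : TermAlgebra} {X Y : Type} (r : X → Y) (v : Y → A.Val)
    (a : Action A X) : (a.map r).eval v = a.eval (v ∘ r) :=
  Action.eval_subst _ _ _

/-- Actions with values as parameters. -/
abbrev ValAct (A : TermAlgebra) : Type := A.Lab × List A.Val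

/-- A valued action as an action term without variables. -/
def ValAct.const {A : TermAlgebra} (X : Type) (b : ValAct A) : Action A X :=
  ⟨b.1, b.2.map Expr.val⟩

theorem ValAct.eval_const {A : TermAlgebra} {X : Type} (b : ValAct A) (v : X → A.Val) :
    (b.const X).eval v = b := by
  rcases b with ⟨l, as⟩
  simp [ValAct.const, Action.eval, Function.comp_def, Expr.eval]

theorem ValAct.sig_const_eval {A : TermAlgebra} {X Y : Type} (a : Action A Y) (v : Y → A.Val) :
    (ValAct.const X (a.eval v)).sig = a.sig := by
  simp [ValAct.const, Action.eval, Action.sig]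

/-- A partial element is determined by a predicate with at most one witness. -/
theorem exists_option_eq_some_iff {α : Type*} {p : α → Prop} (h : ∀ a b, p a → p b → a = b) :
    ∃ o : Option α, ∀ a, o = some a ↔ p a := by
  by_cases hp : ∃ a, p a
  · obtain ⟨a, ha⟩ := hp
    exact ⟨some a, fun b => ⟨fun e => Option.some.inj e ▸ ha, fun hb => congrArg some (h _ _ ha hb)⟩⟩
  · exact ⟨none, fun b => ⟨fun e => (nomatch e), fun hb => (hp ⟨b, hb⟩).elim⟩⟩

/-! ### Refinement of open transitions and their instances. -/

section Refine

variable {A : TermAlgebra} {N V S F F' : Type} (o : OpenTransition A N V S F)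
  (σ : F → Expr A (V ⊕ F')) (q : (V ⊕ F' → A.Val) → Prop) (ρ : V → A.Val) (φ : F' → A.Val)

theorem eval_elim_var (σ : F → Expr A (V ⊕ F')) (ρ : V → A.Val) (φ : F' → A.Val) :
    (fun x => (Sum.elim (fun x => Expr.var (Sum.inl x)) σ x).eval (Sum.elim ρ φ)) =
      Sum.elim ρ (fun x => (σ x).eval (Sum.elim ρ φ)) := by
  funext x
  cases x <;> rfl

theorem OpenTransition.refine_pred :
    (o.refine σ q).pred (Sum.elim ρ φ) ↔
      o.pred (Sum.elim ρ fun x => (σ x).eval (Sum.elim ρ φ)) ∧ q (Sum.elim ρ φ) := by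
  simp only [OpenTransition.refine, eval_elim_var]

theorem OpenTransition.refine_hole (j : N) :
    ((o.refine σ q).hole j).map (Action.eval (Sum.elim ρ φ)) =
      (o.hole j).map (Action.eval (Sum.elim ρ fun x => (σ x).eval (Sum.elim ρ φ))) := by
  simp only [OpenTransition.refine, Option.map_map, Function.comp_def, Action.eval_subst,
    eval_elim_var]

theorem OpenTransition.refine_act :
    (o.refine σ q).act.eval (Sum.elim ρ φ) =
      o.act.eval (Sum.elim ρ fun x => (σ x).eval (Sum.elim ρ φ)) := by
  simp only [OpenTransition.refine, Action.eval_subst, eval_elim_var]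

theorem OpenTransition.refine_after :
    (o.refine σ q).after ρ φ = o.after ρ fun x => (σ x).eval (Sum.elim ρ φ) := by
  funext x
  simp only [OpenTransition.after, OpenTransition.refine]
  cases o.post x with
  | none => rfl
  | some e => simp only [Option.map_some, Option.elim_some, Expr.eval_subst, eval_elim_var]

end Refine

/-- The instance of an open transition for given values of all variables: source, values of the
variables before, actions of the holes, resulting action, target, values of the variables after. -/
def OpenTransition.Fires {A : TermAlgebra} {N V S F : Type} (o : OpenTransition A N V S F)
    (φ : F → A.Val) (s : S) (ρ : V → A.Val) (h : N → Option (ValAct A)) (a : ValAct A)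
    (s' : S) (ρ' : V → A.Val) : Prop :=
  o.src = s ∧ o.pred (Sum.elim ρ φ) ∧ (∀ j, (o.hole j).map (Action.eval (Sum.elim ρ φ)) = h j) ∧
    o.act.eval (Sum.elim ρ φ) = a ∧ o.tgt = s' ∧ o.after ρ φ = ρ'

/-- Refinement creates no new behaviour: the substituted expressions have values, which serve as
values of the original free variables, and the strengthening `q` is dropped. -/
theorem OpenTransition.Fires.of_refine {A : TermAlgebra} {N V S F F' : Type}
    {o : OpenTransition A N V S F} {σ : F → Expr A (V ⊕ F')} {q : (V ⊕ F' → A.Val) → Prop}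
    {φ : F' → A.Val} {s : S} {ρ : V → A.Val} {h : N → Option (ValAct A)} {a : ValAct A}
    {s' : S} {ρ' : V → A.Val} (H : (o.refine σ q).Fires φ s ρ h a s' ρ') :
    o.Fires (fun x => (σ x).eval (Sum.elim ρ φ)) s ρ h a s' ρ' := by
  obtain ⟨h1, h2, h3, h4, h5, h6⟩ := H
  exact ⟨h1, ((o.refine_pred ..).1 h2).1, fun j => (o.refine_hole ..).symm.trans (h3 j),
    (o.refine_act ..).symm.trans h4, h5, (o.refine_after ..).symm.trans h6⟩

/-- Once the free variables are frozen at their values, the type `F'` and the valuation `ψ` are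
arbitrary. This moves an instance to whatever free variables the other automaton's transition uses.
-/
theorem OpenTransition.Fires.refine_val {A : TermAlgebra} {N V S F : Type}
    {o : OpenTransition A N V S F} {φ : F → A.Val} {s : S} {ρ : V → A.Val}
    {h : N → Option (ValAct A)} {a : ValAct A} {s' : S} {ρ' : V → A.Val}
    (H : o.Fires φ s ρ h a s' ρ') (F' : Type) (ψ : F' → A.Val) :
    (o.refine (F' := F') (fun x => Expr.val (φ x)) fun _ => True).Fires ψ s ρ h a s' ρ' := by
  obtain ⟨h1, h2, h3, h4, h5, h6⟩ := H
  exact ⟨h1, (o.refine_pred ..).2 ⟨h2, trivial⟩, fun j => (o.refine_hole ..).trans (h3 j),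
    (o.refine_act ..).trans h4, h5, (o.refine_after ..).trans h6⟩

/-! ### Valued transitions and their simulation. -/

namespace PNet

variable {A : TermAlgebra} {N : Type}

/-- Valued transitions of a pNet: the instances of the open transitions given by its rules. -/
def Step (P : PNet A N) (s : P.State) (ρ : P.Var → A.Val) (h : N → Option (ValAct A))
    (a : ValAct A) (s' : P.State) (ρ' : P.Var → A.Val) : Prop :=
  ∃ g ∈ P.Models, ∃ φ : g.1 → A.Val, g.2.Fires φ s ρ h a s' ρ'

/-- Every valued transition of `P` is matched by one of `P'`. -/
def StepSimulates (P P' : PNet A N)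
    (R : P.State → P'.State → (P.Var → A.Val) → (P'.Var → A.Val) → Prop) : Prop :=
  ∀ s t ρ₁ ρ₂, R s t ρ₁ ρ₂ → ∀ h a s' ρ₁', P.Step s ρ₁ h a s' ρ₁' →
    ∃ t' ρ₂', P'.Step t ρ₂ h a t' ρ₂' ∧ R s' t' ρ₁' ρ₂'

/-- Since families of open transitions may be infinite, simulation of open transitions amounts to
simulation of their instances. -/
theorem simulates_iff {P P' : PNet A N} {R : StateRel P.automaton P'.automaton} :
    Simulates P.automaton P'.automaton R ↔ StepSimulates P P' R := by
  constructor
  · rintro hR s t ρ₁ ρ₂ hst h a s' ρ₁' ⟨g, hg, φ, hf⟩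
    -- Without free variables, the symbolic transition keeps only the chosen instance for the
    -- valuation `ρ₁`.
    have hf' := hf.refine_val Empty Empty.elim
    obtain ⟨X, o', ho', hsim⟩ := hR s t Empty _ ⟨g, hg, _, _, rfl⟩ hf'.1
    obtain ⟨x, hx1, hx2, hx3, hx4⟩ := hsim ρ₁ ρ₂ Empty.elim hst hf'.2.1
    obtain ⟨⟨g', hg', σ, q, hq⟩, hsrc, -⟩ := ho' x
    obtain ⟨-, -, f3, f4, f5, f6⟩ := hf'
    subst f5 f6
    generalize o' x = y at hx1 hx2 hx3 hx4 hq hsrc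
    subst hq
    have hfire : (g'.2.refine σ q).Fires Empty.elim t ρ₂ h a _ _ :=
      ⟨hsrc, hx2, fun j => (hx1 j).symm.trans (f3 j), hx3.symm.trans f4, rfl, rfl⟩
    exact ⟨_, _, ⟨g', hg', _, hfire.of_refine⟩, hx4⟩
  · rintro hR s t F o ⟨g, hg, σ, q, rfl⟩ hs
    -- One member for each valuation satisfying the premise. Every member then has a genuine match,
    -- which also gives the valuation-independent conditions on its source and on the domain of its
    -- hole actions.
    let X : Type := {x : (P.Var → A.Val) × (P'.Var → A.Val) × (F → A.Val) //
      R s t x.1 x.2.1 ∧ (g.2.refine σ q).pred (Sum.elim x.1 x.2.2)}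
    have key : ∀ x : X, ∃ o' ∈ P'.automaton.trans F, ∃ t' ρ₂', o'.Fires x.1.2.2 t x.1.2.1
        (fun j => ((g.2.refine σ q).hole j).map (Action.eval (Sum.elim x.1.1 x.1.2.2)))
        ((g.2.refine σ q).act.eval (Sum.elim x.1.1 x.1.2.2)) t' ρ₂' ∧
        R (g.2.refine σ q).tgt t' ((g.2.refine σ q).after x.1.1 x.1.2.2) ρ₂' := by
      rintro ⟨⟨ρ₁, ρ₂, φ⟩, hst, hp⟩
      have hf : (g.2.refine σ q).Fires φ s ρ₁ _ _ _ _ :=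
        ⟨hs, hp, fun _ => rfl, rfl, rfl, rfl⟩
      obtain ⟨t', ρ₂', ⟨g', hg', φ', hf'⟩, h2⟩ :=
        hR s t ρ₁ ρ₂ hst _ _ _ _ ⟨g, hg, _, hf.of_refine⟩
      exact ⟨_, ⟨g', hg', _, _, rfl⟩, t', ρ₂', hf'.refine_val F φ, h2⟩
    choose o' ho' t' ρ₂' hf hR' using key
    refine ⟨X, o', fun x => ⟨ho' x, (hf x).1, fun j => ?_⟩, fun ρ₁ ρ₂ φ hst hp =>
      ⟨⟨(ρ₁, ρ₂, φ), hst, hp⟩, ?_⟩⟩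
    -- The domain of a family of hole actions can be read off from its values at a single valuation.
    · have := congrArg Option.isSome ((hf x).2.2.1 j)
      rw [Option.isSome_map, Option.isSome_map] at this
      exact this.symm
    · obtain ⟨-, f2, f3, f4, f5, f6⟩ := hf ⟨(ρ₁, ρ₂, φ), hst, hp⟩
      refine ⟨fun j => (f3 j).symm, f2, f4.symm, ?_⟩
      have := hR' ⟨(ρ₁, ρ₂, φ), hst, hp⟩
      rw [← f5, ← f6] at this
      exact this

/-! ### The node rule for valued transitions. -/

section Node

variable {I K : Type} {sub : I → PNet A N} {hole : N → Option (Set (Sig A))}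
  {sv : K → SyncVec A I N}

/-- The part of a state of a node that belongs to a sub-pNet. -/
def subState (s : (node sub hole sv).State) (i : I) : (sub i).State := fun l => s ⟨i, l⟩

/-- The part of a valuation of the variables of a node that belongs to a sub-pNet. -/
def subVal (ρ : (node sub hole sv).Var → A.Val) (i : I) : (sub i).Var → A.Val :=
  fun x => ρ ⟨⟨i, x.1⟩, x.2⟩

theorem node_val_ext {ρ ρ' : (node sub hole sv).Var → A.Val} (h : ∀ i, subVal ρ i = subVal ρ' i) :
    ρ = ρ' :=
  funext fun x => congrFun (h x.1.1) ⟨x.1.2, x.2⟩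

/-- The rule for nodes, for valued transitions. -/
def NodeStep (sub : I → PNet A N) (hole : N → Option (Set (Sig A))) (sv : K → SyncVec A I N)
    (s : (node sub hole sv).State) (ρ : (node sub hole sv).Var → A.Val)
    (h : N → Option (ValAct A)) (a : ValAct A)
    (s' : (node sub hole sv).State) (ρ' : (node sub hole sv).Var → A.Val) : Prop :=
  ∃ (k : K) (val : (sv k).X → A.Val) (hs : I → N → Option (ValAct A)),
    (∀ i α, (sv k).sub i = some α →
      (sub i).Step (subState s i) (subVal ρ i) (hs i) (α.eval val) (subState s' i)
        (subVal ρ' i)) ∧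
    (∀ i, (sv k).sub i = none → subState s' i = subState s i ∧ subVal ρ' i = subVal ρ i) ∧
    (∀ j b, h j = some b ↔ (∃ α, (sv k).hole j = some α ∧ b = α.eval val) ∨
      ∃ i α, (sv k).sub i = some α ∧ hs i j = some b) ∧
    a = (sv k).res.eval val ∧ (sv k).guard.eval val ∈ A.truth

theorem elim_comp_inclVar {k : K} (prem : (i : (sv k).Subs) → (sub i.1).OT)
    (B : (sv k).Holes → Type) (C : Type) (i : (sv k).Subs)
    (ρ : (node sub hole sv).Var → A.Val)
    (φ : NodeFree (sv k).X (fun i => (prem i).1) B C → A.Val) :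
    Sum.elim ρ φ ∘ inclVar hole prem B C i =
      Sum.elim (subVal ρ i.1) (fun x => φ (NodeFree.sub i x)) := by
  funext x
  cases x <;> rfl

theorem eval_map_inclVar {k : K} (prem : (i : (sv k).Subs) → (sub i.1).OT)
    (B : (sv k).Holes → Type) (C : Type) (i : (sv k).Subs)
    (ρ : (node sub hole sv).Var → A.Val)
    (φ : NodeFree (sv k).X (fun i => (prem i).1) B C → A.Val)
    (a : Action A ((sub i.1).Var ⊕ (prem i).1)) :
    (a.map (inclVar hole prem B C i)).eval (Sum.elim ρ φ) =
      a.eval (Sum.elim (subVal ρ i.1) (fun x => φ (NodeFree.sub i x))) :=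
  (Action.eval_map _ _ _).trans (by rw [elim_comp_inclVar])

/-- Each variable of a node belongs to exactly one sub-pNet, so the joint parallel assignment acts
on each component separately and leaves the components outside the vector unchanged. -/
theorem subVal_after_nodeOT (k : K) (prem : (i : (sv k).Subs) → (sub i.1).OT)
    (B : (sv k).Holes → Type) (β : (j : (sv k).Holes) → Action A (B j))
    (C : Type) (α : Action A C) (s s' : (node sub hole sv).State)
    (H : N → Option (Action A ((node sub hole sv).Var ⊕
      NodeFree (sv k).X (fun i => (prem i).1) B C)))
    (ρ : (node sub hole sv).Var → A.Val)
    (φ : NodeFree (sv k).X (fun i => (prem i).1) B C → A.Val) :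
    (∀ i : (sv k).Subs, subVal ((nodeOT k prem B β C α s s' H).2.after ρ φ) i.1 =
      (prem i).2.after (subVal ρ i.1) (fun x => φ (NodeFree.sub i x))) ∧
    ∀ i, (sv k).sub i = none →
      subVal ((nodeOT k prem B β C α s s' H).2.after ρ φ) i = subVal ρ i := by
  constructor
  · intro i
    funext x
    have hi := i.2
    simp only [subVal, OpenTransition.after, nodeOT]
    rw [dif_pos hi]
    change (Option.map _ ((prem i).2.post x)).elim _ _ = ((prem i).2.post x).elim _ _
    cases (prem i).2.post x with
    | none => rfl
    | some e =>
      exact (Expr.eval_map _ _ e).trans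
        (congrArg (fun v => Expr.eval v e) (elim_comp_inclVar prem B C i ρ φ))
  · intro i hi
    funext x
    simp only [subVal, OpenTransition.after, nodeOT]
    rw [dif_neg (by simp [hi])]
    rfl

/-- No well-formedness is needed in this direction: the given open transition already supplies the
union of hole actions as a partial function. -/
theorem Step.nodeStep {s : (node sub hole sv).State} {ρ : (node sub hole sv).Var → A.Val}
    {h : N → Option (ValAct A)} {a : ValAct A} {s' : (node sub hole sv).State}
    {ρ' : (node sub hole sv).Var → A.Val} (hst : (node sub hole sv).Step s ρ h a s' ρ') :
    NodeStep sub hole sv s ρ h a s' ρ' := by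
  classical
  obtain ⟨g, ⟨k, prem, B, β, C, α, s₁, s₁', H, hprem, hsub, hmove, -, hH, rfl⟩, φ, hsrc, hpred,
    hh, ha, htgt, hafter⟩ := hst
  obtain rfl : s₁ = s := hsrc
  obtain rfl : s₁' = s' := htgt
  obtain ⟨hp, hact, hβ, hres, hguard⟩ := hpred
  obtain ⟨af1, af2⟩ := subVal_after_nodeOT k prem B β C α s₁ s₁' H ρ φ
  subst hafter
  -- The value `none` at sub-pNets outside the vector is arbitrary, since `NodeStep` consults `hs`
  -- only at those involved.
  let hs : I → N → Option (ValAct A) := fun i j =>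
    if hi : ((sv k).sub i).isSome then ((prem ⟨i, hi⟩).2.hole j).map
      (Action.eval (Sum.elim (subVal ρ i) fun x => φ (NodeFree.sub ⟨i, hi⟩ x))) else none
  have hs_eq : ∀ (i : (sv k).Subs) j, hs i.1 j = ((prem i).2.hole j).map
      (Action.eval (Sum.elim (subVal ρ i.1) fun x => φ (NodeFree.sub i x))) :=
    fun i j => dif_pos i.2
  refine ⟨k, fun x => φ (NodeFree.vec x), hs, ?_, fun i hi => ⟨?_, af2 i hi⟩, ?_, ?_, hguard⟩
  · intro i α' hi
    have hi' : ((sv k).sub i).isSome := by simp [hi]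
    refine ⟨prem ⟨i, hi'⟩, hprem ⟨i, hi'⟩, fun x => φ (NodeFree.sub ⟨i, hi'⟩ x),
      (hsub ⟨i, hi'⟩).1.symm, ?_, fun j => (hs_eq ⟨i, hi'⟩ j).symm, ?_,
      (hsub ⟨i, hi'⟩).2.symm, (af1 ⟨i, hi'⟩).symm⟩
    · rw [← elim_comp_inclVar prem B C ⟨i, hi'⟩ ρ φ]
      exact hp ⟨i, hi'⟩
    · rw [← elim_comp_inclVar prem B C ⟨i, hi'⟩ ρ φ]
      exact (hact ⟨i, hi'⟩).trans (congrArg (Action.eval _) (Option.get_of_eq_some hi' hi))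
  · funext l
    exact hmove i l (by simp [hi])
  · intro j b
    rw [← hh j, Option.map_eq_some_iff]
    constructor
    · rintro ⟨c, hc, rfl⟩
      rcases (hH j c).1 hc with ⟨hj, rfl⟩ | ⟨i, c', hc', rfl⟩
      · exact Or.inl ⟨((sv k).hole j).get hj, by simp,
          (Action.eval_map _ _ _).trans (hβ ⟨j, hj⟩)⟩
      · refine Or.inr ⟨i.1, (sv k).subAct i, by simp [SyncVec.subAct], ?_⟩
        rw [hs_eq, hc']
        exact congrArg some (eval_map_inclVar prem B C i ρ φ c').symm
    · rintro (⟨α', hα', rfl⟩ | ⟨i, α', hi, hb⟩)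
      · have hj : ((sv k).hole j).isSome := by simp [hα']
        exact ⟨_, (hH j _).2 (Or.inl ⟨hj, rfl⟩), (Action.eval_map _ _ _).trans
          ((hβ ⟨j, hj⟩).trans (congrArg (Action.eval _) (Option.get_of_eq_some hj hα')))⟩
      · have hi' : ((sv k).sub i).isSome := by simp [hi]
        rw [hs_eq ⟨i, hi'⟩, Option.map_eq_some_iff] at hb
        obtain ⟨c, hc, rfl⟩ := hb
        exact ⟨_, (hH j _).2 (Or.inr ⟨⟨i, hi'⟩, c, hc, rfl⟩),
          eval_map_inclVar prem B C ⟨i, hi'⟩ ρ φ c⟩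
  · rw [← ha]
    refine Eq.trans ?_ hres
    exact Action.eval_map _ _ _

/-- The holes of a node have a sort that contains the actions of the vectors and their names
differ from each other and from those of the holes of the sub-pNets, pairwise disjoint. -/
structure HolesWF (sub : I → PNet A N) (hole : N → Option (Set (Sig A)))
    (sv : K → SyncVec A I N) : Prop where
  root : ∀ i, ∀ j ∈ (sub i).holes, hole j = none
  disj : ∀ i₁ i₂, i₁ ≠ i₂ → Disjoint (sub i₁).holes (sub i₂).holes
  sorts : ∀ k j α, (sv k).hole j = some α → ∃ S, hole j = some S ∧ α.sig ∈ S

theorem WF.holesWF (h : (node sub hole sv).WF) : HolesWF sub hole sv where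
  root := h.2.2.1
  disj := h.2.2.2.1
  sorts k j α hα := by
    obtain ⟨S, h1, h2⟩ := (h.2.2.2.2 k).2.1 ⟨j, by simp [hα]⟩
    refine ⟨S, h1, ?_⟩
    simpa [SyncVec.holeAct, hα] using h2

theorem mem_holes_of_models {P : PNet A N} {o : P.OT} (ho : o ∈ P.Models) {j : N}
    {b : Action A (P.Var ⊕ o.1)} (h : o.2.hole j = some b) : j ∈ P.holes :=
  let ⟨S, hS, _⟩ := P.typed_of_models o ho j b h
  ⟨S, hS⟩

theorem Step.mem_holes {P : PNet A N} {s : P.State} {ρ : P.Var → A.Val}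
    {h : N → Option (ValAct A)} {a : ValAct A} {s' : P.State} {ρ' : P.Var → A.Val}
    (hst : P.Step s ρ h a s' ρ') {j : N} {b : ValAct A} (hj : h j = some b) : j ∈ P.holes := by
  obtain ⟨g, hg, φ, -, -, hh, -⟩ := hst
  rw [← hh j, Option.map_eq_some_iff] at hj
  obtain ⟨c, hc, -⟩ := hj
  exact mem_holes_of_models hg hc

/-- The fresh actions can be taken to be constants, namely the values they must have. Disjointness
of hole names makes the union of the hole actions single-valued, and the sort condition on vectors
makes the constants admissible. -/
theorem NodeStep.step (hwf : HolesWF sub hole sv)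
    {s : (node sub hole sv).State} {ρ : (node sub hole sv).Var → A.Val}
    {h : N → Option (ValAct A)} {a : ValAct A} {s' : (node sub hole sv).State}
    {ρ' : (node sub hole sv).Var → A.Val} (hst : NodeStep sub hole sv s ρ h a s' ρ') :
    (node sub hole sv).Step s ρ h a s' ρ' := by
  obtain ⟨k, val, hs, hsub, hmove, hh, rfl, hguard⟩ := hst
  have hsub' : ∀ i : (sv k).Subs, (sub i.1).Step (subState s i.1) (subVal ρ i.1) (hs i.1)
      (((sv k).subAct i).eval val) (subState s' i.1) (subVal ρ' i.1) :=
    fun i => hsub i.1 _ (by simp [SyncVec.subAct])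
  choose prem hprem φ hf using hsub'
  let B : (sv k).Holes → Type := fun _ => Empty
  let β : (j : (sv k).Holes) → Action A (B j) :=
    fun j => ValAct.const Empty (((sv k).holeAct j).eval val)
  let α : Action A Empty := ValAct.const Empty ((sv k).res.eval val)
  -- Freshness keeps the groups of free variables apart, so their valuations glue without conflict.
  let ψ : NodeFree (sv k).X (fun i => (prem i).1) B Empty → A.Val := fun y =>
    match y with
    | NodeFree.vec x => val x
    | NodeFree.sub i x => φ i x
    | NodeFree.hole _ x => x.elim
    | NodeFree.res x => x.elim
  have hholes : ∀ j, ∃ o : Option (Action A ((node sub hole sv).Var ⊕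
      NodeFree (sv k).X (fun i => (prem i).1) B Empty)), ∀ c, o = some c ↔
        (∃ h : ((sv k).hole j).isSome,
          c = (β ⟨j, h⟩).map (fun x => Sum.inr (NodeFree.hole ⟨j, h⟩ x))) ∨
        ∃ i a', (prem i).2.hole j = some a' ∧ c = a'.map (inclVar hole prem B Empty i) := by
    intro j
    -- A name cannot receive an action both from the node itself and from a sub-pNet.
    have hne : ((sv k).hole j).isSome → ∀ i a', (prem i).2.hole j = some a' → False := by
      intro hj i a' ha'
      obtain ⟨S, hS, -⟩ := hwf.sorts k j _ (Option.some_get hj).symm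
      rw [hwf.root i.1 j (mem_holes_of_models (hprem i) ha')] at hS
      cases hS
    apply exists_option_eq_some_iff
    rintro c d (⟨hj, rfl⟩ | ⟨i, c', hc', rfl⟩) (⟨hj', rfl⟩ | ⟨i', d', hd', rfl⟩)
    · rfl
    · exact (hne hj i' d' hd').elim
    · exact (hne hj' i c' hc').elim
    · obtain rfl : i = i' := by
        by_contra hii
        exact Set.disjoint_left.1 (hwf.disj i.1 i'.1 fun e => hii (Subtype.ext e))
          (mem_holes_of_models (hprem i) hc') (mem_holes_of_models (hprem i') hd')
      rw [hc'] at hd'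
      cases hd'
      rfl
  choose H hH using hholes
  obtain ⟨af1, af2⟩ := subVal_after_nodeOT k prem B β Empty α s s' H ρ ψ
  refine ⟨nodeOT k prem B β Empty α s s' H, ⟨k, prem, B, β, Empty, α, s, s', H, hprem,
    fun i => ⟨(hf i).1.symm, (hf i).2.2.2.2.1.symm⟩, fun i l hi => ?_, fun j => ?_, hH, rfl⟩, ψ,
    rfl, ⟨fun i => ?_, fun i => ?_, fun j => ?_, ValAct.eval_const _ _, hguard⟩, fun j => ?_, ?_,
    rfl, ?_⟩
  · exact congrFun (hmove i (by simpa using hi)).1 l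
  · obtain ⟨S, h1, h2⟩ := hwf.sorts k j.1 _ (Option.some_get j.2).symm
    exact ⟨S, h1, Set.mem_of_eq_of_mem (ValAct.sig_const_eval _ _) h2⟩
  · exact (congrArg (prem i).2.pred (elim_comp_inclVar prem B Empty i ρ ψ)).mpr (hf i).2.1
  · exact (congrArg (fun v => Action.eval v _) (elim_comp_inclVar prem B Empty i ρ ψ)).trans
      (hf i).2.2.2.1
  · exact ValAct.eval_const _ _
  · apply Option.ext
    intro b
    rw [hh j, Option.map_eq_some_iff]
    constructor
    · rintro ⟨c, hc, rfl⟩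
      rcases (hH j c).1 hc with ⟨hj, rfl⟩ | ⟨i, c', hc', rfl⟩
      · exact Or.inl ⟨((sv k).hole j).get hj, by simp,
          (Action.eval_map _ _ _).trans (ValAct.eval_const _ _)⟩
      · refine Or.inr ⟨i.1, (sv k).subAct i, by simp [SyncVec.subAct], ?_⟩
        rw [← (hf i).2.2.1 j, hc']
        exact congrArg some (eval_map_inclVar prem B Empty i ρ ψ c').symm
    · rintro (⟨α', hα', rfl⟩ | ⟨i, α', hi, hb⟩)
      · have hj : ((sv k).hole j).isSome := by simp [hα']
        exact ⟨_, (hH j _).2 (Or.inl ⟨hj, rfl⟩), (Action.eval_map _ _ _).trans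
          ((ValAct.eval_const _ _).trans
            (congrArg (Action.eval _) (Option.get_of_eq_some hj hα')))⟩
      · have hi' : ((sv k).sub i).isSome := by simp [hi]
        rw [← (hf ⟨i, hi'⟩).2.2.1 j, Option.map_eq_some_iff] at hb
        obtain ⟨c, hc, rfl⟩ := hb
        exact ⟨_, (hH j _).2 (Or.inr ⟨⟨i, hi'⟩, c, hc, rfl⟩),
          eval_map_inclVar prem B Empty ⟨i, hi'⟩ ρ ψ c⟩
  · exact (Action.eval_map _ _ _).trans (ValAct.eval_const _ _)
  · apply node_val_ext
    intro i
    rcases hi : (sv k).sub i with _ | c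
    · rw [af2 i hi, (hmove i hi).2]
    · have hi' : ((sv k).sub i).isSome := by simp [hi]
      exact (af1 ⟨i, hi'⟩).trans (hf ⟨i, hi'⟩).2.2.2.2.2

end Node

/-! ### Decomposition of the steps of a composition. -/

section Fill

variable {A : TermAlgebra} {N : Type} {I K : Type} {sub : I → PNet A N}
  {hole : N → Option (Set (Sig A))} {sv : K → SyncVec A I N} {j₀ : N} {Q : PNet A N}

/-- The sub-pNets of a composition. -/
abbrev fillSub (Q : PNet A N) (sub : I → PNet A N) : Option I → PNet A N
  | none => Q
  | some i => sub i

/-- The composition `P[Q]_{j₀}` where `P` is a node, as a node. -/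
theorem fill_node : (node sub hole sv).fill j₀ Q = node (fillSub Q sub)
    (@Function.update _ _ (fun a b => Classical.propDecidable (a = b)) hole j₀ none)
    (fun k => (sv k).fill j₀) := by
  unfold fill
  congr 1

variable {hole' : N → Option (Set (Sig A))}

/-- The part of a state of a composition that belongs to the context. -/
def outerState (hole : N → Option (Set (Sig A)))
    (s : (node (fillSub Q sub) hole' fun k => (sv k).fill j₀).State) :
    (node sub hole sv).State :=
  fun l => s ⟨some l.1, l.2⟩

/-- The part of a valuation of a composition that belongs to the context. -/
def outerVal (hole : N → Option (Set (Sig A)))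
    (ρ : (node (fillSub Q sub) hole' fun k => (sv k).fill j₀).Var → A.Val) :
    (node sub hole sv).Var → A.Val :=
  fun x => ρ ⟨⟨some x.1.1, x.1.2⟩, x.2⟩

/-- The state of a composition given by states of the context and of the pNet in the hole. -/
def pairState (s : (node sub hole sv).State) (q : Q.State) :
    (node (fillSub Q sub) hole' fun k => (sv k).fill j₀).State
  | ⟨none, l⟩ => q l
  | ⟨some i, l⟩ => s ⟨i, l⟩

/-- The valuation of the variables of a composition given by valuations of the variables of the
context and of the pNet in the hole. -/
def pairVal (ρ : (node sub hole sv).Var → A.Val) (q : Q.Var → A.Val) :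
    (node (fillSub Q sub) hole' fun k => (sv k).fill j₀).Var → A.Val
  | ⟨⟨none, l⟩, x⟩ => q ⟨l, x⟩
  | ⟨⟨some i, l⟩, x⟩ => ρ ⟨⟨i, l⟩, x⟩

/-- `h` is the union of the family `hP` without its member at `j₀` and of the family `hQ`. -/
def ComposedHoles (j₀ : N) (hP hQ h : N → Option (ValAct A)) : Prop :=
  ∀ j b, h j = some b ↔ (j ≠ j₀ ∧ hP j = some b) ∨ hQ j = some b

theorem fill_hole_eq_some {v : SyncVec A I N} {j : N} {α : Action A v.X} :
    (v.fill j₀).hole j = some α ↔ j ≠ j₀ ∧ v.hole j = some α := by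
  by_cases h : j = j₀
  · subst h
    simp [SyncVec.fill]
  · simp [SyncVec.fill, h]

/-- A valued transition of a composition consists of one of the context and, if this involves the
hole, one of the pNet in the hole with the action of the hole as result. -/
theorem nodeStep_fill_iff (hj₀ : ∀ i, j₀ ∉ (sub i).holes)
    {s : (node (fillSub Q sub) hole' fun k => (sv k).fill j₀).State}
    {ρ : (node (fillSub Q sub) hole' fun k => (sv k).fill j₀).Var → A.Val}
    {h : N → Option (ValAct A)} {a : ValAct A}
    {s' : (node (fillSub Q sub) hole' fun k => (sv k).fill j₀).State}
    {ρ' : (node (fillSub Q sub) hole' fun k => (sv k).fill j₀).Var → A.Val} :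
    NodeStep (fillSub Q sub) hole' (fun k => (sv k).fill j₀) s ρ h a s' ρ' ↔
      ∃ hP hQ, NodeStep sub hole sv (outerState hole s) (outerVal hole ρ) hP a
        (outerState hole s') (outerVal hole ρ') ∧
        ((hP j₀ = none ∧ hQ = (fun _ => none) ∧ subState s' none = subState s none ∧
          subVal ρ' none = subVal ρ none) ∨
        ∃ b, hP j₀ = some b ∧ Q.Step (subState s none) (subVal ρ none) hQ b
          (subState s' none) (subVal ρ' none)) ∧
        ComposedHoles j₀ hP hQ h := by
  constructor
  · rintro ⟨k, val, hs, hsub, hmove, hh, ha, hg⟩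
    -- Only the root of the context can act at `j₀`; this makes the action there identify what `Q`
    -- has to do.
    have hs₀ : ∀ i α, (sv k).sub i = some α → hs (some i) j₀ = none := by
      intro i α hi
      apply Option.eq_none_iff_forall_ne_some.2
      exact fun b hb => hj₀ i ((hsub (some i) α hi).mem_holes hb)
    -- The hole family of the context must be shown single-valued. Away from `j₀` its members are
    -- members of `h`; at `j₀` the vector is the only source.
    have hP : ∀ j, ∃ o : Option (ValAct A), ∀ b, o = some b ↔
        (∃ α, (sv k).hole j = some α ∧ b = α.eval val) ∨
          ∃ i α, (sv k).sub i = some α ∧ hs (some i) j = some b := by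
      intro j
      apply exists_option_eq_some_iff
      by_cases hj : j = j₀
      · subst hj
        rintro b c (⟨α, hα, rfl⟩ | ⟨i, α, hi, hb⟩) (⟨α', hα', rfl⟩ | ⟨i', α', hi', hb'⟩)
        · rw [hα] at hα'
          cases hα'
          rfl
        · rw [hs₀ i' α' hi'] at hb'
          cases hb'
        · rw [hs₀ i α hi] at hb
          cases hb
        · rw [hs₀ i α hi] at hb
          cases hb
      · have key : ∀ b, ((∃ α, (sv k).hole j = some α ∧ b = α.eval val) ∨
            ∃ i α, (sv k).sub i = some α ∧ hs (some i) j = some b) → h j = some b := by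
          rintro b (⟨α, hα, hb⟩ | ⟨i, α, hi, hb⟩)
          · exact (hh j b).2 (Or.inl ⟨α, fill_hole_eq_some.2 ⟨hj, hα⟩, hb⟩)
          · exact (hh j b).2 (Or.inr ⟨some i, α, hi, hb⟩)
        exact fun b c hb hc => Option.some.inj ((key b hb).symm.trans (key c hc))
    choose hP hP' using hP
    have hstep : NodeStep sub hole sv (outerState hole s) (outerVal hole ρ) hP a
        (outerState hole s') (outerVal hole ρ') :=
      ⟨k, val, fun i => hs (some i), fun i => hsub (some i), fun i => hmove (some i), hP', ha, hg⟩
    rcases hv : (sv k).hole j₀ with _ | α₀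
    · refine ⟨hP, fun _ => none, hstep, Or.inl ⟨?_, rfl, hmove none hv⟩, fun j b => ?_⟩
      · apply Option.eq_none_iff_forall_ne_some.2
        intro b hb
        rcases (hP' j₀ b).1 hb with ⟨α, hα, -⟩ | ⟨i, α, hi, hb⟩
        · rw [hv] at hα
          cases hα
        · rw [hs₀ i α hi] at hb
          cases hb
      · rw [hh]
        constructor
        · rintro (⟨α, hα, hb⟩ | ⟨_ | i, α, hi, hb⟩)
          · obtain ⟨hj, hα⟩ := fill_hole_eq_some.1 hα
            exact Or.inl ⟨hj, (hP' j b).2 (Or.inl ⟨α, hα, hb⟩)⟩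
          · exact nomatch hv.symm.trans hi
          · refine Or.inl ⟨?_, (hP' j b).2 (Or.inr ⟨i, α, hi, hb⟩)⟩
            rintro rfl
            exact nomatch (hs₀ i α hi).symm.trans hb
        · rintro (⟨hj, hb⟩ | hb)
          · rcases (hP' j b).1 hb with ⟨α, hα, hb⟩ | ⟨i, α, hi, hb⟩
            · exact Or.inl ⟨α, fill_hole_eq_some.2 ⟨hj, hα⟩, hb⟩
            · exact Or.inr ⟨some i, α, hi, hb⟩
          · cases hb
    · refine ⟨hP, hs none, hstep, Or.inr ⟨α₀.eval val, (hP' _ _).2 (Or.inl ⟨α₀, hv, rfl⟩),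
        hsub none α₀ hv⟩, fun j b => ?_⟩
      rw [hh]
      constructor
      · rintro (⟨α, hα, hb⟩ | ⟨_ | i, α, hi, hb⟩)
        · obtain ⟨hj, hα⟩ := fill_hole_eq_some.1 hα
          exact Or.inl ⟨hj, (hP' j b).2 (Or.inl ⟨α, hα, hb⟩)⟩
        · exact Or.inr hb
        · refine Or.inl ⟨?_, (hP' j b).2 (Or.inr ⟨i, α, hi, hb⟩)⟩
          rintro rfl
          exact nomatch (hs₀ i α hi).symm.trans hb
      · rintro (⟨hj, hb⟩ | hb)
        · rcases (hP' j b).1 hb with ⟨α, hα, hb⟩ | ⟨i, α, hi, hb⟩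
          · exact Or.inl ⟨α, fill_hole_eq_some.2 ⟨hj, hα⟩, hb⟩
          · exact Or.inr ⟨some i, α, hi, hb⟩
        · exact Or.inr ⟨none, α₀, hv, hb⟩
  · rintro ⟨hP, hQ, ⟨k, val, hs, hsub, hmove, hh, ha, hg⟩, hq, hcomp⟩
    have hs₀ : ∀ i α, (sv k).sub i = some α → hs i j₀ = none := by
      intro i α hi
      apply Option.eq_none_iff_forall_ne_some.2
      exact fun b hb => hj₀ i ((hsub i α hi).mem_holes hb)
    -- The same vector and valuation serve the composition; `Q` contributes its own hole actions at
    -- the index `none`.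
    refine ⟨k, val, fun i => i.elim hQ hs, ?_, ?_, fun j b => ?_, ha, hg⟩
    · rintro (_ | i) α hi
      · have hb := (hh j₀ (α.eval val)).2 (Or.inl ⟨α, hi, rfl⟩)
        rcases hq with ⟨hn, -⟩ | ⟨b, hb', hstep⟩
        · exact nomatch hn.symm.trans hb
        · cases hb.symm.trans hb'
          exact hstep
      · exact hsub i α hi
    · rintro (_ | i) hi
      · rcases hq with ⟨-, -, hn⟩ | ⟨b, hb', hstep⟩
        · exact hn
        · rcases (hh j₀ b).1 hb' with ⟨α, hα, -⟩ | ⟨i, α, hi', hb⟩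
          · exact nomatch hα.symm.trans hi
          · exact nomatch (hs₀ i α hi').symm.trans hb
      · exact hmove i hi
    · rw [hcomp j b]
      constructor
      · rintro (⟨hj, hb⟩ | hb)
        · rcases (hh j b).1 hb with ⟨α, hα, hb⟩ | ⟨i, α, hi, hb⟩
          · exact Or.inl ⟨α, fill_hole_eq_some.2 ⟨hj, hα⟩, hb⟩
          · exact Or.inr ⟨some i, α, hi, hb⟩
        · rcases hq with ⟨-, rfl, -⟩ | ⟨c, hc, -⟩
          · cases hb
          · rcases (hh j₀ c).1 hc with ⟨α, hα, -⟩ | ⟨i, α, hi', hb'⟩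
            · exact Or.inr ⟨none, α, hα, hb⟩
            · exact nomatch (hs₀ i α hi').symm.trans hb'
      · rintro (⟨α, hα, hb⟩ | ⟨_ | i, α, hi, hb⟩)
        · obtain ⟨hj, hα⟩ := fill_hole_eq_some.1 hα
          exact Or.inl ⟨hj, (hh j b).2 (Or.inl ⟨α, hα, hb⟩)⟩
        · exact Or.inr hb
        · refine Or.inl ⟨?_, (hh j b).2 (Or.inr ⟨i, α, hi, hb⟩)⟩
          rintro rfl
          exact nomatch (hs₀ i α hi).symm.trans hb

theorem subset_holes (i : I) : (sub i).holes ⊆ (node sub hole sv).holes :=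
  fun _ ⟨S, hS⟩ => ⟨S, Or.inr ⟨i, hS⟩⟩

open Classical in
-- A hole of `Q` may itself be named `j₀`: that name has been freed at the root, and no other
-- sub-pNet uses it because it was a root hole. All other names are separated by `hdisj`.
theorem HolesWF.fill (hwf : HolesWF sub hole sv) {S₀ : Set (Sig A)} (h₀ : hole j₀ = some S₀)
    (hdisj : Disjoint Q.holes ((node sub hole sv).holes \ {j₀})) :
    HolesWF (fillSub Q sub) (Function.update hole j₀ none) (fun k => (sv k).fill j₀) := by
  have hdis : ∀ i, Disjoint Q.holes (sub i).holes := by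
    intro i
    refine Set.disjoint_left.2 fun j hj hj' => Set.disjoint_left.1 hdisj hj
      ⟨subset_holes i hj', ?_⟩
    rintro rfl
    exact nomatch h₀.symm.trans (hwf.root i _ hj')
  constructor
  · rintro i j hj
    rw [Function.update_apply]
    split_ifs with h
    · rfl
    · rcases i with _ | i
      · apply Option.eq_none_iff_forall_ne_some.2
        exact fun S hS => Set.disjoint_left.1 hdisj hj ⟨⟨S, Or.inl hS⟩, h⟩
      · exact hwf.root i j hj
  · rintro (_ | i₁) (_ | i₂) hne
    · exact (hne rfl).elim
    · exact hdis i₂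
    · exact (hdis i₁).symm
    · exact hwf.disj i₁ i₂ fun e => hne (congrArg some e)
  · intro k j α hα
    obtain ⟨hj, hα⟩ := fill_hole_eq_some.1 hα
    obtain ⟨S, h1, h2⟩ := hwf.sorts k j α hα
    exact ⟨S, by rwa [Function.update_of_ne hj], h2⟩

open Classical in
-- As only the root carries `j₀`, deleting it there deletes it from the whole context. The holes of
-- the composition thus depend on the context only through its set of sorted holes, which bisimilar
-- contexts share.
theorem sortedHoles_fill (hj₀ : ∀ i, j₀ ∉ (sub i).holes) :
    (node (fillSub Q sub) (Function.update hole j₀ none) fun k => (sv k).fill j₀).sortedHoles =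
      {x ∈ (node sub hole sv).sortedHoles | x.1 ≠ j₀} ∪ Q.sortedHoles := by
  ext ⟨j, S⟩
  constructor
  · rintro (h | ⟨_ | i, h⟩)
    · by_cases hj : j = j₀
      · subst hj
        simp at h
      · exact Or.inl ⟨Or.inl (by simpa [hj] using h), hj⟩
    · exact Or.inr h
    · refine Or.inl ⟨Or.inr ⟨i, h⟩, ?_⟩
      rintro rfl
      exact hj₀ i ⟨S, h⟩
  · rintro (⟨h | ⟨i, h⟩, hj⟩ | h)
    · exact Or.inl ((Function.update_of_ne hj _ _).trans h)
    · exact Or.inr ⟨some i, h⟩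
    · exact Or.inr ⟨none, h⟩

/-! ### Bisimulation of compositions. -/

variable {I₂ K₂ : Type} {sub₂ : I₂ → PNet A N} {hole₂ hole₂' : N → Option (Set (Sig A))}
  {sv₂ : K₂ → SyncVec A I₂ N}

/-- The relation between two compositions that is given by a relation between the contexts: the
states and the variables of the pNet in the hole agree. -/
def fillRel (R : (node sub hole sv).State → (node sub₂ hole₂ sv₂).State →
      ((node sub hole sv).Var → A.Val) → ((node sub₂ hole₂ sv₂).Var → A.Val) → Prop)
    (s : (node (fillSub Q sub) hole' fun k => (sv k).fill j₀).State)
    (t : (node (fillSub Q sub₂) hole₂' fun k => (sv₂ k).fill j₀).State)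
    (ρ₁ : (node (fillSub Q sub) hole' fun k => (sv k).fill j₀).Var → A.Val)
    (ρ₂ : (node (fillSub Q sub₂) hole₂' fun k => (sv₂ k).fill j₀).Var → A.Val) : Prop :=
  (subState s none : Q.State) = subState t none ∧
    (subVal ρ₁ none : Q.Var → A.Val) = subVal ρ₂ none ∧
    R (outerState hole s) (outerState hole₂ t) (outerVal hole ρ₁) (outerVal hole₂ ρ₂)

/-- The matching context step has the same hole family `hP`, in particular the same action or
inaction at `j₀`, so the unchanged behaviour of `Q` fits it. -/
theorem StepSimulates.fill {R : (node sub hole sv).State → (node sub₂ hole₂ sv₂).State →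
      ((node sub hole sv).Var → A.Val) → ((node sub₂ hole₂ sv₂).Var → A.Val) → Prop}
    (hR : StepSimulates (node sub hole sv) (node sub₂ hole₂ sv₂) R)
    (hj₀ : ∀ i, j₀ ∉ (sub i).holes) (hj₀' : ∀ i, j₀ ∉ (sub₂ i).holes)
    (hwf : HolesWF sub hole sv)
    (hwf' : HolesWF (fillSub Q sub₂) hole₂' fun k => (sv₂ k).fill j₀) :
    StepSimulates (node (fillSub Q sub) hole' fun k => (sv k).fill j₀)
      (node (fillSub Q sub₂) hole₂' fun k => (sv₂ k).fill j₀) (fillRel R) := by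
  rintro s t ρ₁ ρ₂ ⟨hq, hρ, hst⟩ h a s' ρ₁' hstep
  obtain ⟨hP, hQ, hs, hcase, hcomp⟩ := (nodeStep_fill_iff (hole := hole) hj₀).1 hstep.nodeStep
  obtain ⟨t', ρ₂', ht, hst'⟩ := hR _ _ _ _ hst _ _ _ _ (hs.step hwf)
  refine ⟨pairState t' (subState s' none), pairVal ρ₂' (subVal ρ₁' none),
    NodeStep.step hwf' ((nodeStep_fill_iff (hole := hole₂) hj₀').2
      ⟨hP, hQ, ht.nodeStep, ?_, hcomp⟩), rfl, rfl, hst'⟩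
  -- Both compositions start with the same state and valuation of `Q`, so its behaviour transfers
  -- verbatim.
  rw [← hq, ← hρ]
  exact hcase

open Classical in
/-- Bisimilar contexts stay bisimilar when a hole of the root of both is filled. -/
theorem FHBisimilar.fill {P P' Q : PNet A N} (hP : P.WF) (hP' : P'.WF) {j₀ : N}
    {S : Set (Sig A)} (hj : P.rootHole j₀ = some S) (hj' : P'.rootHole j₀ = some S)
    (hdisj : Disjoint Q.holes (P.holes \ {j₀})) (hPP' : P.FHBisimilar P') :
    (P.fill j₀ Q).FHBisimilar (P'.fill j₀ Q) := by
  rcases P with _ | @⟨I, K, sub, hole, sv⟩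
  · cases hj
  rcases P' with _ | @⟨I₂, K₂, sub₂, hole₂, sv₂⟩
  · cases hj'
  obtain ⟨R, ⟨hholes, hl, hr⟩, ρ, ρ', hρ, hρ', hinit⟩ := hPP'
  have hwf := hP.holesWF
  have hwf₂ := hP'.holesWF
  have hj₀ : ∀ i, j₀ ∉ (sub i).holes := fun i h => nomatch hj.symm.trans (hwf.root i _ h)
  have hj₀' : ∀ i, j₀ ∉ (sub₂ i).holes := fun i h => nomatch hj'.symm.trans (hwf₂.root i _ h)
  have hh : (node sub hole sv).sortedHoles = (node sub₂ hole₂ sv₂).sortedHoles := hholes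
  -- Bisimilar pNets have the same holes, so the assumption on `P` carries over to `P'`.
  have hdisj' : Disjoint Q.holes ((node sub₂ hole₂ sv₂).holes \ {j₀}) := by
    have : (node sub₂ hole₂ sv₂).holes = (node sub hole sv).holes := by
      unfold PNet.holes
      rw [hh]
    rwa [this]
  have hfill := hwf.fill hj hdisj
  have hfill₂ := hwf₂.fill hj' hdisj'
  rw [fill_node, fill_node]
  refine ⟨fillRel R, ⟨?_, ?_, ?_⟩, ?_⟩
  · refine (sortedHoles_fill (sv := sv) hj₀).trans
      (Eq.trans ?_ (sortedHoles_fill (sv := sv₂) hj₀').symm)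
    rw [hh]
  · exact simulates_iff.2 ((simulates_iff.1 hl).fill hj₀ hj₀' hwf hfill₂)
  -- Filling the reversed relation gives the reverse of `fillRel R` only up to the orientation of
  -- the two equalities on the `Q` part, which are flipped by hand.
  · have := simulates_iff.2 ((simulates_iff.1 hr).fill (Q := Q)
      (hole' := Function.update hole₂ j₀ none) hj₀' hj₀ hwf₂ hfill)
    intro t s F o ho hs
    obtain ⟨X, o', h1, h2⟩ := this t s F o ho hs
    exact ⟨X, o', h1, fun ρ₁ ρ₂ φ ⟨e1, e2, e3⟩ hp =>
      let ⟨x, g1, g2, g3, f1, f2, f3⟩ := h2 ρ₁ ρ₂ φ ⟨e1.symm, e2.symm, e3⟩ hp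
      ⟨x, g1, g2, g3, f1.symm, f2.symm, f3⟩⟩
  · obtain ⟨c₀⟩ := A.nonempty_val
    -- Both compositions use this one valuation of `Q`, as `fillRel` requires; `c₀` fills in for
    -- variables without an initial value.
    let q : Q.Var → A.Val := fun x => (Q.initVal x).getD c₀
    have hq : ∀ x c, Q.initVal x = some c → q x = c := fun x c h => by simp [q, h]
    refine ⟨pairVal ρ q, pairVal ρ' q, ?_, ?_, rfl, rfl, hinit⟩
    · rintro ⟨⟨_ | i, l⟩, x⟩ c h
      · exact hq ⟨l, x⟩ c h
      · exact hρ ⟨⟨i, l⟩, x⟩ c h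
    · rintro ⟨⟨_ | i, l⟩, x⟩ c h
      · exact hq ⟨l, x⟩ c h
      · exact hρ' ⟨⟨i, l⟩, x⟩ c h

end Fill

end PNet

end PNets

theorem mainTheorem2 (A : PNets.TermAlgebra) (N : Type) (P P' Q : PNets.PNet A N)
    (hP : P.WF) (hP' : P'.WF) (hQ : Q.WF) (j₀ : N)
    (hj : P.rootHole j₀ = some Q.sort) (hj' : P'.rootHole j₀ = some Q.sort)
    (hdisj : Disjoint Q.holes (P.holes \ {j₀}))
    (hPP' : P.FHBisimilar P') :
    (P.fill j₀ Q).FHBisimilar (P'.fill j₀ Q) :=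
  hPP'.fill hP hP' hj hj' hdisj
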